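/- **Conventions.** A polyhedron is a subset $P$ of a real normed space that is the underlying set $|K|$ of a locally finite geometric simplicial complex $K$ (every point of $P$ has a neighborhood meeting only finitely many simplices); such a $K$ is called a triangulation of $P$. A map on $P$ is PL if it is affine on each simplex of some triangulation of $P$. A PL homeomorphism is a bijection that is PL together with its inverse. For a compact $G$, $c(G)$ denotes the open cone on $G$, with $c(\emptyset)$ a point. A *stratified PL-pseudomanifold* of dimension $n$ is a polyhedron $X$ with a filtration $\emptyset=X_{-1}\subset X_0\subset\cdots\subset X_n=X$ by closed subpolyhedra such that * $X_{n-2}$ has dimension at most $n-2$, and $X-X_{n-2}$ is a PL $n$-manifold dense in $X$; * every $y\in X_i-X_{i-1}$ has an open neighborhood $U$ in $X$ for which there are a compact polyhedron $G$ with a filtration $\emptyset=G_{-1}\subset G_0\subset\cdots\subset G_{n-i-1}=G$ by closed subsets and a PL homeomorphism $\mathbb R^i\times c(G)\to U$ taking $\mathbb R^i\times c(G_{j-1})$ onto $X_{i+j}\cap U$ for every $0\le j\le n-i$. Let $Y\subset X$ be a subpolyhedron. Suppose that $B$ is a triangulation of $X$ in which $Y$ and all the $X_i$ are triangulated by full subcomplexes,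 and that $B'$ is a first derived subdivision of $B$ (obtained from an arbitrary choice of an interior point in each simplex of $B$). Let $B'_i$ be the part of $B'$ subdividing $X_i$. For a complex $C$, let $\bar N(Y,C)$ be the subcomplex consisting of the simplices of $C$ that meet $Y$ and all their faces, and let $\mathrm{lk}(Y,C)$ be the subcomplex of those simplices of $\bar N(Y,C)$ that do not meet $Y$. Put $V=|\bar N(Y,B')|$, $V_i=|\bar N(Y,B_i')|$ and $\mathrm{fr}(V)=|\mathrm{lk}(Y,B')|$. An *open regular neighborhood* of $Y$ in $X$ is a filtered space $(N,\{N_i\})$ of the form $N=V-\mathrm{fr}(V)$, $N_i=N\cap V_i$. **Lemma.** Let $X$ be a stratified PL-pseudomanifold of dimension $n$, let $X_k$ be its bottom stratum (that is, $X_k\neq\emptyset$ and $X_i=\emptyset$ for $i<k$), and let $(N,\{N_i\})$ be an open regular neighborhood of $X_k$ in $X$. Then there is a nearly stratum-preserving deformation retraction of $N$ to $X_k$ in $N$. Explicitly, $X_k\subset N$ and, with $I=[0,1]$, there is a continuous map $R:N\times I\to N$ such that 1. $R(x,1)=x$ for all $x\in N$; 2. $R(x,t)=x$ for all $x\in X_k$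 and $t\in I$; 3. $R(x,0)\in X_k$ for all $x\in N$; 4. for each $x\in N$ the set $R(\{x\}\times(0,1])$ is contained in a single stratum $N_i-N_{i-1}$ of $N$. -/

import Mathlib

open Set Topology

namespace StratPL

section Polyhedra

variable {E F : Type*} [NormedAddCommGroup E] [NormedSpace ℝ E]
  [NormedAddCommGroup F] [NormedSpace ℝ F]

/-- A simplicial complex is locally finite if every point of its underlying space has a
neighbourhood that meets only finitely many of its simplices. -/
def IsLocallyFinite (K : Geometry.SimplicialComplex ℝ E) : Prop :=
  ∀ x ∈ K.space, ∃ U ∈ 𝓝 x,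
    {s ∈ K.faces | (convexHull ℝ (s : Set E) ∩ U).Nonempty}.Finite

/-- `K` is a (locally finite, linear) triangulation of `P`. -/
def IsTriangulation (K : Geometry.SimplicialComplex ℝ E) (P : Set E) : Prop :=
  IsLocallyFinite K ∧ K.space = P

/-- A polyhedron: a set that has a locally finite triangulation. -/
def IsPolyhedron (P : Set E) : Prop :=
  ∃ K : Geometry.SimplicialComplex ℝ E, IsTriangulation K P

/-- The polyhedron `P` has dimension at most `d` (only the empty one has dimension `< 0`). -/
def HasDimLE (P : Set E) (d : ℤ) : Prop :=
  ∃ K : Geometry.SimplicialComplex ℝ E, IsTriangulation K P ∧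
    ∀ s ∈ K.faces, (s.card : ℤ) ≤ d + 1

/-- `f` is piecewise linear on the polyhedron `P`: it is affine on each simplex of some
locally finite triangulation of `P`. (Only the values of `f` on `P` matter.) -/
def IsPLOn (f : E → F) (P : Set E) : Prop :=
  ∃ K : Geometry.SimplicialComplex ℝ E, IsTriangulation K P ∧
    ∀ s ∈ K.faces, ∃ a : E →ᵃ[ℝ] F, EqOn f a (convexHull ℝ (s : Set E))

/-- `f` restricts to a piecewise linear homeomorphism of `P` onto `Q`. -/
def IsPLHomeo (f : E → F) (P : Set E) (Q : Set F) : Prop :=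
  IsPLOn f P ∧ MapsTo f P Q ∧
    ∃ g : F → E, IsPLOn g Q ∧ MapsTo g Q P ∧ InvOn g f P Q

/-- `M` is a piecewise linear manifold (without boundary) of dimension `n`. -/
def IsPLManifold (n : ℕ) (M : Set E) : Prop :=
  ∀ x ∈ M, ∃ U : Set E, IsOpen U ∧ x ∈ U ∧
    ∃ f : EuclideanSpace ℝ (Fin n) → E, IsPLHomeo f univ (M ∩ U)

/-- The open cone `c(G) = ([0,1) × G) / ({0} × G)` on a compact set `G`, realized in `F × ℝ` as the
union of the half-open segments from the cone point `0` towards the points `(g, 1)`, `g ∈ G`.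
In particular `c(∅)` is a point. -/
def openCone (G : Set F) : Set (F × ℝ) :=
  insert 0 {p | ∃ t ∈ Ioo (0 : ℝ) 1, ∃ g ∈ G, p = (t • g, t)}

end Polyhedra

section Stratified

variable {E : Type*} [NormedAddCommGroup E] [NormedSpace ℝ E]

/-- `∅ = S (-1) ⊆ S 0 ⊆ ⋯ ⊆ S n = X` is a filtration of `X` by closed subspaces; the indexing is
extended to `ℤ` by `S i = ∅` for `i < 0` and `S i = X` for `i ≥ n`. -/
structure IsFiltration (X : Set E) (n : ℤ) (S : ℤ → Set E) : Prop where
  mono : Monotone S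
  eq_empty : ∀ i < 0, S i = ∅
  eq_total : ∀ i, n ≤ i → S i = X
  closed : ∀ i, ∃ C : Set E, IsClosed C ∧ S i = X ∩ C

/-- The `i`-th stratum `S i - S (i - 1)` of a filtration. -/
def stratum (S : ℤ → Set E) (i : ℤ) : Set E := S i \ S (i - 1)

/-- `X` is a PL-pseudomanifold of dimension `n` with closed PL subspace `Sing` of
codimension at least two whose complement is a dense PL manifold of dimension `n`. -/
structure IsPLPseudomanifold (n : ℕ) (X Sing : Set E) : Prop where
  polyhedron : IsPolyhedron X
  closed : ∃ C : Set E, IsClosed C ∧ Sing = X ∩ C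
  codim : HasDimLE Sing ((n : ℤ) - 2)
  manifold : IsPLManifold n (X \ Sing)
  dense : X ⊆ closure (X \ Sing)

/-- The point `y` of the `i`-th stratum has a distinguished neighbourhood `X ∩ U` in `X`: there are
a compact polyhedron `G` (the link) with a filtration
`∅ = L (-1) ⊆ L 0 ⊆ ⋯ ⊆ L (n - i - 1) = G` and a PL homeomorphism `φ` of `ℝ^i × c(G)` onto `X ∩ U`
that takes `ℝ^i × c(L (j - 1))` onto `S (i + j) ∩ U` for every `j ≥ 0`. -/
def HasDistinguishedNbhd (n : ℕ) (X : Set E) (S : ℤ → Set E) (i : ℕ) (y : E) : Prop :=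
  ∃ U : Set E, IsOpen U ∧ y ∈ U ∧
    ∃ (m : ℕ) (G : Set (EuclideanSpace ℝ (Fin m))) (L : ℤ → Set (EuclideanSpace ℝ (Fin m)))
      (φ : EuclideanSpace ℝ (Fin i) × (EuclideanSpace ℝ (Fin m) × ℝ) → E),
      IsPolyhedron G ∧ IsCompact G ∧ IsFiltration G ((n : ℤ) - i - 1) L ∧
      IsPLHomeo φ (univ ×ˢ openCone G) (X ∩ U) ∧
      ∀ j : ℕ, φ '' (univ ×ˢ openCone (L ((j : ℤ) - 1))) = S ((i : ℤ) + j) ∩ U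

/-- `(X, S)` is a stratified PL-pseudomanifold of dimension `n` with polyhedral skeleta. -/
structure IsStratifiedPLPseudomanifold (n : ℕ) (X : Set E) (S : ℤ → Set E) : Prop where
  filtration : IsFiltration X n S
  polyhedral : ∀ i, IsPolyhedron (S i)
  pseudomanifold : IsPLPseudomanifold n X (S ((n : ℤ) - 2))
  locallyTrivial : ∀ i : ℕ, ∀ y ∈ stratum S i, HasDistinguishedNbhd n X S i y

end Stratified

section RegularNeighborhoods

variable {E : Type*} [NormedAddCommGroup E] [NormedSpace ℝ E]

/-- `A` is a full subcomplex of `B`. -/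
def IsFullSubcomplex (A B : Geometry.SimplicialComplex ℝ E) : Prop :=
  A.faces ⊆ B.faces ∧ ∀ s ∈ B.faces, (∀ v ∈ s, v ∈ A.vertices) → s ∈ A.faces

/-- The open simplex (relative interior of the simplex) with vertex set `s`. -/
def openSimplex (s : Finset E) : Set E :=
  {x | ∃ w : E → ℝ, (∀ v ∈ s, 0 < w v) ∧ ∑ v ∈ s, w v = 1 ∧ ∑ v ∈ s, w v • v = x}

/-- `B'` is a first derived subdivision of `B`: for some choice of a point `p s` in the interior of
each simplex `s` of `B`, the simplices of `B'` are those spanned by the points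
`p (s 0), …, p (s q)` for the nonempty finite chains `s 0 ⊂ ⋯ ⊂ s q` of simplices of `B`. -/
def IsFirstDerived (B B' : Geometry.SimplicialComplex ℝ E) : Prop :=
  ∃ p : Finset E → E, (∀ s ∈ B.faces, p s ∈ openSimplex s) ∧
    ∀ t : Finset E, t ∈ B'.faces ↔
      ∃ c : Finset (Finset E), c.Nonempty ∧ (c : Set (Finset E)) ⊆ B.faces ∧
        IsChain (· ⊆ ·) (c : Set (Finset E)) ∧ (t : Set E) = p '' (c : Set (Finset E))

/-- The simplices of the closed simplicial neighbourhood of `Y` in the complex with simplices `T`: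
the simplices in `T` that meet `Y`, together with all their faces. -/
def nbhdFaces (Y : Set E) (T : Set (Finset E)) : Set (Finset E) :=
  {s ∈ T | ∃ t ∈ T, s ⊆ t ∧ (convexHull ℝ (t : Set E) ∩ Y).Nonempty}

/-- The simplices of the link of `Y`: the simplices of the closed simplicial neighbourhood of `Y`
that do not meet `Y`. -/
def linkFaces (Y : Set E) (T : Set (Finset E)) : Set (Finset E) :=
  {s ∈ nbhdFaces Y T | Disjoint (convexHull ℝ (s : Set E)) Y}

/-- The simplices in `T` contained in the set `Z`. -/
def facesIn (T : Set (Finset E)) (Z : Set E) : Set (Finset E) :=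
  {s ∈ T | convexHull ℝ (s : Set E) ⊆ Z}

/-- The underlying space of a collection of simplices. -/
def carrier (T : Set (Finset E)) : Set E := ⋃ s ∈ T, convexHull ℝ (s : Set E)

/-- `(V, Vf)` is a (closed) regular neighbourhood, with frontier `fr`, of `Y` in the filtered
polyhedron `(X, S)`: there are a triangulation `B` of `X` in which `Y` and the `S i` are
triangulated by full subcomplexes and a first derived subdivision `B'` of `B` such that `V` and
`fr` are the closed simplicial neighbourhood and the link of `Y` in `B'`, and `Vf i` is the closed
simplicial neighbourhood of `Y` in the part of `B'` that subdivides `S i`. -/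
def IsRegularNbhd (X : Set E) (S : ℤ → Set E) (Y V : Set E) (Vf : ℤ → Set E) (fr : Set E) : Prop :=
  ∃ B B' : Geometry.SimplicialComplex ℝ E, IsTriangulation B X ∧
    (∃ A, IsFullSubcomplex A B ∧ A.space = Y) ∧
    (∀ i, ∃ A, IsFullSubcomplex A B ∧ A.space = S i) ∧
    IsFirstDerived B B' ∧
    V = carrier (nbhdFaces Y B'.faces) ∧
    (∀ i, Vf i = carrier (nbhdFaces Y (facesIn B'.faces (S i)))) ∧
    fr = carrier (linkFaces Y B'.faces)

/-- `(N, Nf)` is an open regular neighbourhood of `Y` in the filtered polyhedron `(X, S)`: a regular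
neighbourhood with its frontier removed, with the induced filtration. -/
def IsOpenRegularNbhd (X : Set E) (S : ℤ → Set E) (Y N : Set E) (Nf : ℤ → Set E) : Prop :=
  ∃ (V : Set E) (Vf : ℤ → Set E) (fr : Set E), IsRegularNbhd X S Y V Vf fr ∧
    N = V \ fr ∧ ∀ i, Nf i = N ∩ Vf i

/-- `R : N × I → N` is a nearly stratum-preserving deformation retraction of the filtered space
`(N, Nf)` to its subspace `Y`: it is the identity at time `1`, it fixes `Y` at all times, it maps
`N` into `Y` at time `0`, and every point stays in one stratum during the times in `(0, 1]`. -/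
structure IsNearlyStratumPreservingDefRetract (N : Set E) (Nf : ℤ → Set E) (Y : Set E)
    (R : C(N × unitInterval, N)) : Prop where
  subset : Y ⊆ N
  at_one : ∀ x : N, R (x, 1) = x
  fixes : ∀ x : N, (x : E) ∈ Y → ∀ t, R (x, t) = x
  at_zero : ∀ x : N, (R (x, 0) : E) ∈ Y
  stratum_preserving : ∀ x : N, ∃ i : ℤ, ∀ t : unitInterval, 0 < t →
    (R (x, t) : E) ∈ stratum Nf i

end RegularNeighborhoods

end StratPL

/-! Call `K` the derived triangulation and `Y` the bottom stratum. Removing the link from the closed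
simplicial neighborhood of `Y` leaves the open star: the union of the open simplices of `K` with a
vertex in `Y` (`carrier_nbhdFaces_diff_carrier_linkFaces`). On it the barycentric coordinates at
vertices in `Y` have positive sum; discarding the others and normalizing gives a retraction to `Y`,
and `R` moves each point linearly along the segment to its image.

For `t > 0` no coordinate that was positive becomes zero, so a point stays in its open simplex
(`lineMap_starRetraction_mem`). Strata are unions of open simplices within the star: an open simplex
of `K` lies in the open simplex of `B` at the top of its chain, and so meets a subcomplex of `B`
only if contained in it (`IsFirstDerived.mem_space_iff`). Local finiteness passes to `K` and makes
`R` continuous. -/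

namespace StratPL

/-! ### Open simplices of a simplicial complex -/

section OpenSimplices

variable {E : Type*} [NormedAddCommGroup E] [NormedSpace ℝ E]

theorem openSimplex_subset_convexHull (s : Finset E) :
    openSimplex s ⊆ convexHull ℝ (s : Set E) := by
  rintro x ⟨w, hw, h1, hx⟩
  exact Finset.mem_convexHull'.2 ⟨w, fun v hv => (hw v hv).le, h1, hx⟩

theorem exists_subset_mem_openSimplex {s : Finset E} {x : E}
    (hx : x ∈ convexHull ℝ (s : Set E)) : ∃ t ⊆ s, t.Nonempty ∧ x ∈ openSimplex t := by
  classical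
  obtain ⟨w, hw, h1, hx⟩ := Finset.mem_convexHull'.1 hx
  have hz : ∀ v ∈ s, v ∉ s.filter (fun v => 0 < w v) → w v = 0 := fun v hv hv' =>
    le_antisymm (not_lt.1 fun h => hv' (Finset.mem_filter.2 ⟨hv, h⟩)) (hw v hv)
  have h1' : ∑ v ∈ s.filter (fun v => 0 < w v), w v = 1 := by
    rw [← h1]
    exact Finset.sum_subset (Finset.filter_subset _ _) hz
  refine ⟨s.filter (fun v => 0 < w v), Finset.filter_subset _ _, ?_, w, ?_, h1', ?_⟩
  · rw [Finset.nonempty_iff_ne_empty]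
    intro h
    simp [h] at h1'
  · exact fun v hv => (Finset.mem_filter.1 hv).2
  · rw [← hx]
    exact Finset.sum_subset (Finset.filter_subset _ _) fun v hv hv' => by simp [hz v hv hv']

/-- A convex combination of points of a simplex lies in the open simplex as soon as a point of the
open simplex has positive weight in it. -/
theorem sum_smul_mem_openSimplex {m t : Finset E} {w : E → ℝ} (hw : ∀ v ∈ t, 0 ≤ w v)
    (h1 : ∑ v ∈ t, w v = 1) (ht : ∀ v ∈ t, v ∈ convexHull ℝ (m : Set E))
    {v₀ : E} (hv₀ : v₀ ∈ t) (hpos : 0 < w v₀) (hm : v₀ ∈ openSimplex m) :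
    ∑ v ∈ t, w v • v ∈ openSimplex m := by
  classical
  -- Expand every point over the vertices of `m`; the expansion of `v₀` is strictly positive, which
  -- makes the combined weights positive.
  have key : ∀ v ∈ t, ∃ u : E → ℝ, (∀ y ∈ m, 0 ≤ u y) ∧ (v = v₀ → ∀ y ∈ m, 0 < u y) ∧
      ∑ y ∈ m, u y = 1 ∧ ∑ y ∈ m, u y • y = v := by
    intro v hv
    by_cases h : v = v₀
    · obtain ⟨u, hu, hu1, hux⟩ := hm
      exact ⟨u, fun y hy => (hu y hy).le, fun _ => hu, hu1, hux.trans h.symm⟩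
    · obtain ⟨u, hu, hu1, hux⟩ := Finset.mem_convexHull'.1 (ht v hv)
      exact ⟨u, hu, fun h' => (h h').elim, hu1, hux⟩
  choose! u hu hu0 hu1 hux using key
  refine ⟨fun y => ∑ v ∈ t, w v * u v y, fun y hy => ?_, ?_, ?_⟩
  · exact Finset.sum_pos' (fun v hv => mul_nonneg (hw v hv) (hu v hv y hy))
      ⟨v₀, hv₀, mul_pos hpos (hu0 v₀ hv₀ rfl y hy)⟩
  · rw [Finset.sum_comm, ← h1]
    exact Finset.sum_congr rfl fun v hv => by rw [← Finset.mul_sum, hu1 v hv, mul_one]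
  · simp_rw [Finset.sum_smul]
    rw [Finset.sum_comm]
    exact Finset.sum_congr rfl fun v hv => by
      simp_rw [mul_smul]
      rw [← Finset.smul_sum, hux v hv]

variable {K : Geometry.SimplicialComplex ℝ E}

theorem weights_eq {s : Finset E} (hs : s ∈ K.faces) {w w' : E → ℝ}
    (h1 : ∑ v ∈ s, w v = ∑ v ∈ s, w' v) (hx : ∑ v ∈ s, w v • v = ∑ v ∈ s, w' v • v) :
    ∀ v ∈ s, w v = w' v :=
  (K.indep hs).eq_of_sum_eq_sum_subtype h1 hx

/-- In a simplicial complex, a simplex containing a point of an open simplex contains the whole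
simplex. -/
theorem subset_of_mem_openSimplex {s t : Finset E} (hs : s ∈ K.faces) (ht : t ∈ K.faces) {x : E}
    (hxs : x ∈ openSimplex s) (hxt : x ∈ convexHull ℝ (t : Set E)) : s ⊆ t := by
  classical
  have hx := K.inter_subset_convexHull hs ht ⟨openSimplex_subset_convexHull s hxs, hxt⟩
  rw [← Finset.coe_inter] at hx
  obtain ⟨u, -, hu1, hux⟩ := Finset.mem_convexHull'.1 hx
  obtain ⟨w, hw, hw1, hwx⟩ := hxs
  -- The weights over `s ∩ t`, extended by zero, and the positive weights over `s` give the same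
  -- point; affine independence equates them.
  have e : ∀ v ∈ s, w v = if v ∈ t then u v else 0 := by
    refine weights_eq hs ?_ ?_
    · rw [← Finset.sum_filter, Finset.filter_mem_eq_inter, hw1, hu1]
    · simp_rw [ite_smul, zero_smul]
      rw [← Finset.sum_filter, Finset.filter_mem_eq_inter, hwx, hux]
  intro v hv
  by_contra h
  have := e v hv
  rw [if_neg h] at this
  exact (hw v hv).ne' this

theorem openSimplex_inj {s t : Finset E} (hs : s ∈ K.faces) (ht : t ∈ K.faces) {x : E}
    (hxs : x ∈ openSimplex s) (hxt : x ∈ openSimplex t) : s = t :=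
  (subset_of_mem_openSimplex hs ht hxs (openSimplex_subset_convexHull t hxt)).antisymm
    (subset_of_mem_openSimplex ht hs hxt (openSimplex_subset_convexHull s hxs))

theorem exists_face_mem_openSimplex {s : Finset E} (hs : s ∈ K.faces) {x : E}
    (hx : x ∈ convexHull ℝ (s : Set E)) : ∃ t ∈ K.faces, t ⊆ s ∧ x ∈ openSimplex t := by
  obtain ⟨t, hts, ht, hxt⟩ := exists_subset_mem_openSimplex hx
  exact ⟨t, K.down_closed hs hts ht, hts, hxt⟩

end OpenSimplices

/-! ### Barycentric coordinates -/

section BarycentricCoordinates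

variable {E : Type*} [NormedAddCommGroup E] [NormedSpace ℝ E]
  (K : Geometry.SimplicialComplex ℝ E)

open Classical in
/-- The barycentric coordinate of the point `x` of `K` at `v`; it is `0` unless `v` is a vertex of
the open simplex that contains `x`. -/
noncomputable def baryCoord (x v : E) : ℝ :=
  if h : ∃ s ∈ K.faces, x ∈ openSimplex s then
    if v ∈ h.choose then h.choose_spec.2.choose v else 0
  else 0

variable {K}

theorem baryCoord_spec {s : Finset E} (hs : s ∈ K.faces) {x : E} (hx : x ∈ openSimplex s) :
    (∀ v ∈ s, 0 < baryCoord K x v) ∧ (∀ v ∉ s, baryCoord K x v = 0) ∧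
      ∑ v ∈ s, baryCoord K x v = 1 ∧ ∑ v ∈ s, baryCoord K x v • v = x := by
  classical
  have h : ∃ s ∈ K.faces, x ∈ openSimplex s := ⟨s, hs, hx⟩
  obtain ⟨u, e, hw, h1, hwx⟩ : ∃ u : E → ℝ, (∀ v, baryCoord K x v = if v ∈ s then u v else 0) ∧
      (∀ v ∈ s, 0 < u v) ∧ ∑ v ∈ s, u v = 1 ∧ ∑ v ∈ s, u v • v = x := by
    have e := openSimplex_inj h.choose_spec.1 hs h.choose_spec.2 hx
    have hu := h.choose_spec.2.choose_spec
    refine ⟨h.choose_spec.2.choose, fun v => ?_, ?_⟩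
    · rw [baryCoord, dif_pos h]
      exact if_congr (by rw [e]) rfl rfl
    -- The chosen weights are abstracted first, as they mention the chosen face that `e` rewrites.
    · generalize h.choose_spec.2.choose = u at hu
      rwa [e] at hu
  have e' : ∀ v ∈ s, baryCoord K x v = u v := fun v hv => by rw [e, if_pos hv]
  refine ⟨fun v hv => ?_, fun v hv => ?_, ?_, ?_⟩
  · rw [e' v hv]
    exact hw v hv
  · rw [e, if_neg hv]
  · exact (Finset.sum_congr rfl e').trans h1
  · exact (Finset.sum_congr rfl fun v hv => by rw [e' v hv]).trans hwx

theorem baryCoord_nonneg (x v : E) : 0 ≤ baryCoord K x v := by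
  by_cases h : ∃ s ∈ K.faces, x ∈ openSimplex s
  · obtain ⟨s, hs, hx⟩ := h
    by_cases hv : v ∈ s
    · exact ((baryCoord_spec hs hx).1 v hv).le
    · exact ((baryCoord_spec hs hx).2.1 v hv).ge
  · rw [baryCoord, dif_neg h]

section

variable {t : Finset E} (ht : t ∈ K.faces) {x : E} (hx : x ∈ convexHull ℝ (t : Set E))

include ht hx

theorem baryCoord_eq_zero {v : E} (hv : v ∉ t) : baryCoord K x v = 0 := by
  obtain ⟨s, hs, hst, hxs⟩ := exists_face_mem_openSimplex ht hx
  exact (baryCoord_spec hs hxs).2.1 v fun h => hv (hst h)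

theorem sum_baryCoord : ∑ v ∈ t, baryCoord K x v = 1 := by
  obtain ⟨s, hs, hst, hxs⟩ := exists_face_mem_openSimplex ht hx
  rw [← (baryCoord_spec hs hxs).2.2.1]
  exact (Finset.sum_subset hst fun v _ hv => (baryCoord_spec hs hxs).2.1 v hv).symm

theorem sum_baryCoord_smul : ∑ v ∈ t, baryCoord K x v • v = x := by
  obtain ⟨s, hs, hst, hxs⟩ := exists_face_mem_openSimplex ht hx
  nth_rw 2 [← (baryCoord_spec hs hxs).2.2.2]
  exact (Finset.sum_subset hst fun v _ hv => by rw [(baryCoord_spec hs hxs).2.1 v hv, zero_smul]).symm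

end

/-- Affine independence makes the map from weights to points injective on the compact standard
simplex, hence a closed embedding; the coordinates are its inverse. -/
theorem continuousOn_baryCoord {t : Finset E} (ht : t ∈ K.faces) (v : E) :
    ContinuousOn (fun x => baryCoord K x v) (convexHull ℝ (t : Set E)) := by
  by_cases hv : v ∈ t
  · let f : stdSimplex ℝ t → E := fun w => ∑ v : t, w.1 v • (v : E)
    have hf : Continuous f := by
      refine continuous_finsetSum _ fun v _ => Continuous.smul ?_ continuous_const
      exact (continuous_apply v).comp continuous_subtype_val
    have hinj : Function.Injective f := by
      intro w w' h
      refine Subtype.ext (funext fun v => ?_)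
      exact (K.indep ht).eq_of_sum_eq_sum (s := Finset.univ)
        (w.2.2.trans w'.2.2.symm) h v (Finset.mem_univ v)
    have hemb : IsClosedEmbedding f := hf.isClosedEmbedding hinj
    let g : convexHull ℝ (t : Set E) → stdSimplex ℝ t := fun x =>
      ⟨fun v => baryCoord K x v, fun v => baryCoord_nonneg _ _, by
        rw [Finset.univ_eq_attach, Finset.sum_attach t (fun v => baryCoord K x v)]
        exact sum_baryCoord ht x.2⟩
    have hg : Continuous g := by
      rw [hemb.isInducing.continuous_iff]
      convert continuous_subtype_val using 1
      funext x
      change ∑ v : t, baryCoord K x v • (v : E) = x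
      rw [Finset.univ_eq_attach, Finset.sum_attach t (fun v => baryCoord K x v • v)]
      exact sum_baryCoord_smul ht x.2
    rw [continuousOn_iff_continuous_domRestrict]
    exact (continuous_apply (⟨v, hv⟩ : t)).comp (continuous_subtype_val.comp hg)
  · exact continuousOn_const.congr fun x hx => baryCoord_eq_zero ht hx hv

end BarycentricCoordinates

/-! ### The retraction of an open star -/

section Retraction

variable {E : Type*} [NormedAddCommGroup E] [NormedSpace ℝ E]
  (K : Geometry.SimplicialComplex ℝ E) (Y : Set E)

/-- The union of the open simplices of `K` that have a vertex in `Y`. -/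
def openStar : Set E := {x | ∃ s ∈ K.faces, x ∈ openSimplex s ∧ ∃ v ∈ s, v ∈ Y}

/-- The total weight of the barycentric coordinates of `x` at the vertices in `Y`. -/
noncomputable def massOn (x : E) : ℝ := ∑ᶠ v, Y.indicator (baryCoord K x) v

/-- The retraction of the open star of `Y`: drop the vertices outside `Y` and normalize. -/
noncomputable def starRetraction (x : E) : E :=
  (massOn K Y x)⁻¹ • ∑ᶠ v, Y.indicator (baryCoord K x) v • v

variable {K Y}

section

variable {t : Finset E} (ht : t ∈ K.faces) {x : E} (hx : x ∈ convexHull ℝ (t : Set E))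

include ht hx

/-- Coordinates vanish off the vertices of any face containing `x`, so one formula serves the whole
closed simplex; continuity can then be checked simplex by simplex. -/
theorem massOn_eq_sum : massOn K Y x = ∑ v ∈ t, Y.indicator (baryCoord K x) v := by
  refine finsum_eq_sum_of_support_subset _ fun v hv => ?_
  by_contra h
  refine hv ?_
  by_cases hY : v ∈ Y
  · rw [indicator_of_mem hY, baryCoord_eq_zero ht hx h]
  · rw [indicator_of_notMem hY]

theorem starRetraction_eq_sum : starRetraction K Y x =
    (massOn K Y x)⁻¹ • ∑ v ∈ t, Y.indicator (baryCoord K x) v • v := by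
  rw [starRetraction]
  congr 1
  refine finsum_eq_sum_of_support_subset _ fun v hv => ?_
  by_contra h
  refine hv ?_
  by_cases hY : v ∈ Y
  · simp only [indicator_of_mem hY, baryCoord_eq_zero ht hx h, zero_smul]
  · simp only [indicator_of_notMem hY, zero_smul]

end

theorem indicator_baryCoord_nonneg (x v : E) : 0 ≤ Y.indicator (baryCoord K x) v :=
  indicator_nonneg (fun v _ => baryCoord_nonneg x v) v

theorem massOn_pos {x : E} (hx : x ∈ openStar K Y) : 0 < massOn K Y x := by
  obtain ⟨s, hs, hxs, v, hv, hvY⟩ := hx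
  rw [massOn_eq_sum hs (openSimplex_subset_convexHull s hxs)]
  refine Finset.sum_pos' (fun v _ => indicator_baryCoord_nonneg x v) ⟨v, hv, ?_⟩
  rw [indicator_of_mem hvY]
  exact (baryCoord_spec hs hxs).1 v hv

theorem continuousOn_indicator_baryCoord {t : Finset E} (ht : t ∈ K.faces) (v : E) :
    ContinuousOn (fun x => Y.indicator (baryCoord K x) v) (convexHull ℝ (t : Set E)) := by
  by_cases hv : v ∈ Y
  · simpa only [indicator_of_mem hv] using continuousOn_baryCoord ht v
  · simpa only [indicator_of_notMem hv] using continuousOn_const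

theorem continuousOn_starRetraction {t : Finset E} (ht : t ∈ K.faces) :
    ContinuousOn (starRetraction K Y) (convexHull ℝ (t : Set E) ∩ openStar K Y) := by
  have hc : ContinuousOn (fun x => (∑ v ∈ t, Y.indicator (baryCoord K x) v)⁻¹ •
      ∑ v ∈ t, Y.indicator (baryCoord K x) v • v) (convexHull ℝ (t : Set E) ∩ openStar K Y) := by
    refine ContinuousOn.smul (ContinuousOn.inv₀ ?_ fun x hx => ?_) ?_
    · exact continuousOn_finsetSum _ fun v _ =>
        (continuousOn_indicator_baryCoord ht v).mono inter_subset_left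
    · rw [← massOn_eq_sum ht hx.1]
      exact (massOn_pos hx.2).ne'
    · exact continuousOn_finsetSum _ fun v _ =>
        ((continuousOn_indicator_baryCoord ht v).mono inter_subset_left).smul continuousOn_const
  exact hc.congr fun x hx => by rw [starRetraction_eq_sum ht hx.1, massOn_eq_sum ht hx.1]

/-- Moving a point of the open star towards its retraction does not leave its open simplex until
the end. -/
theorem lineMap_starRetraction_mem {s : Finset E} (hs : s ∈ K.faces) {x : E}
    (hx : x ∈ openSimplex s) (hxY : x ∈ openStar K Y) {t : ℝ} (ht0 : 0 < t) (ht1 : t ≤ 1) :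
    AffineMap.lineMap (starRetraction K Y x) x t ∈ openSimplex s := by
  have hxs := openSimplex_subset_convexHull s hx
  have hpos := massOn_pos hxY
  have ha := massOn_eq_sum (Y := Y) hs hxs
  -- The first summand is nonnegative, and the second is positive on `s` because `0 < t`.
  refine ⟨fun v => (1 - t) * ((massOn K Y x)⁻¹ * Y.indicator (baryCoord K x) v) +
    t * baryCoord K x v, fun v hv => ?_, ?_, ?_⟩
  · refine add_pos_of_nonneg_of_pos (mul_nonneg (by linarith) (mul_nonneg (inv_nonneg.2 hpos.le)
      (indicator_baryCoord_nonneg x v))) (mul_pos ht0 ((baryCoord_spec hs hx).1 v hv))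
  · rw [Finset.sum_add_distrib, ← Finset.mul_sum, ← Finset.mul_sum, ← Finset.mul_sum,
      sum_baryCoord hs hxs, ← ha, inv_mul_cancel₀ hpos.ne']
    ring
  · rw [AffineMap.lineMap_apply_module, starRetraction_eq_sum hs hxs]
    simp_rw [add_smul, mul_smul, Finset.sum_add_distrib, ← Finset.smul_sum]
    rw [sum_baryCoord_smul hs hxs]

/-- The vertices that survive form a face, nonempty by the definition of the open star, and their
rescaled weights remain positive. -/
theorem exists_starRetraction_mem {x : E} (hx : x ∈ openStar K Y) :
    ∃ s ∈ K.faces, (∀ v ∈ s, v ∈ Y) ∧ starRetraction K Y x ∈ openSimplex s := by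
  classical
  have hpos := massOn_pos hx
  obtain ⟨s, hs, hxs, v, hv, hvY⟩ := hx
  have hxs' := openSimplex_subset_convexHull s hxs
  refine ⟨s.filter (· ∈ Y), K.down_closed hs (Finset.filter_subset _ _)
    ⟨v, Finset.mem_filter.2 ⟨hv, hvY⟩⟩, fun v hv => (Finset.mem_filter.1 hv).2,
    fun v => (massOn K Y x)⁻¹ * Y.indicator (baryCoord K x) v, fun v hv => ?_, ?_, ?_⟩
  · obtain ⟨hv, hvY⟩ := Finset.mem_filter.1 hv
    beta_reduce
    rw [indicator_of_mem hvY]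
    exact mul_pos (inv_pos.2 hpos) ((baryCoord_spec hs hxs).1 v hv)
  · rw [← Finset.mul_sum, Finset.sum_filter_of_ne, ← massOn_eq_sum hs hxs',
      inv_mul_cancel₀ hpos.ne']
    exact fun v _ h => by_contra fun hv => h (indicator_of_notMem hv _)
  · rw [starRetraction_eq_sum hs hxs', Finset.smul_sum]
    simp_rw [mul_smul]
    refine Finset.sum_filter_of_ne fun v _ h => by_contra fun hv => h ?_
    rw [indicator_of_notMem hv, zero_smul, smul_zero]

theorem starRetraction_eq_self {s : Finset E} (hs : s ∈ K.faces) (hsY : ∀ v ∈ s, v ∈ Y) {x : E}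
    (hx : x ∈ openSimplex s) : starRetraction K Y x = x := by
  have hxs := openSimplex_subset_convexHull s hx
  have e : ∀ v ∈ s, Y.indicator (baryCoord K x) v = baryCoord K x v :=
    fun v hv => indicator_of_mem (hsY v hv) _
  rw [starRetraction_eq_sum hs hxs, massOn_eq_sum hs hxs, Finset.sum_congr rfl e,
    sum_baryCoord hs hxs, inv_one, one_smul,
    Finset.sum_congr rfl fun v hv => by rw [e v hv], sum_baryCoord_smul hs hxs]

/-- Continuity on each closed simplex glues, since the simplices form a locally finite closed cover
of the star. -/
theorem continuousOn_starRetraction_openStar (hK : IsLocallyFinite K) :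
    ContinuousOn (starRetraction K Y) (openStar K Y) := by
  rw [continuousOn_iff_continuous_domRestrict]
  let f : K.faces → Set (openStar K Y) := fun t => Subtype.val ⁻¹' convexHull ℝ (t.1 : Set E)
  have hsub : ∀ x : openStar K Y, ∃ s ∈ K.faces, (x : E) ∈ convexHull ℝ (s : Set E) := by
    rintro ⟨x, s, hs, hx, -⟩
    exact ⟨s, hs, openSimplex_subset_convexHull s hx⟩
  have hf : LocallyFinite f := by
    intro x
    obtain ⟨U, hU, hfin⟩ := hK x (Geometry.SimplicialComplex.mem_space_iff.2 (hsub x))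
    refine ⟨Subtype.val ⁻¹' U, continuous_subtype_val.continuousAt.preimage_mem_nhds hU, ?_⟩
    refine Finite.of_finite_image (f := Subtype.val) (hfin.subset ?_) Subtype.val_injective.injOn
    rintro _ ⟨t, ⟨y, hy, hyU⟩, rfl⟩
    exact ⟨t.2, y, hy, hyU⟩
  refine hf.continuous ?_ ?_ ?_
  · refine eq_univ_of_forall fun x => ?_
    obtain ⟨s, hs, hx⟩ := hsub x
    exact mem_iUnion.2 ⟨⟨s, hs⟩, hx⟩
  · exact fun t => (t.1.1.finite_toSet.isClosed_convexHull ℝ).preimage continuous_subtype_val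
  · intro t
    exact (continuousOn_starRetraction t.2).comp continuous_subtype_val.continuousOn
      fun x hx => ⟨hx, x.2⟩

end Retraction

/-! ### First derived subdivisions -/

section DerivedSubdivision

theorem exists_greatest_of_isChain {ι : Type*} {c : Finset (Finset ι)} (hc : c.Nonempty)
    (hchain : IsChain (· ⊆ ·) (c : Set (Finset ι))) : ∃ m ∈ c, ∀ s ∈ c, s ⊆ m := by
  obtain ⟨m, hm, hmax⟩ := c.exists_max_image Finset.card hc
  refine ⟨m, hm, fun s hs => ?_⟩
  rcases hchain.total hs hm with h | h
  · exact h
  · exact (Finset.eq_of_subset_of_card_le h (hmax s hs)).ge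

variable {E : Type*} [NormedAddCommGroup E] [NormedSpace ℝ E]
  {A B B' : Geometry.SimplicialComplex ℝ E}

theorem mem_space_iff_mem_faces (hAB : A.faces ⊆ B.faces) {s : Finset E} (hs : s ∈ B.faces) {x : E}
    (hx : x ∈ openSimplex s) : x ∈ A.space ↔ s ∈ A.faces := by
  rw [Geometry.SimplicialComplex.mem_space_iff]
  constructor
  · rintro ⟨t, ht, hxt⟩
    exact A.down_closed ht (subset_of_mem_openSimplex hs (hAB ht) hx hxt)
      (B.nonempty_of_mem_faces hs)
  · exact fun h => ⟨s, h, openSimplex_subset_convexHull s hx⟩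

/-- Every open simplex of a first derived subdivision lies in the open simplex that is the greatest
element of its chain, and a subcomplex contains the latter as soon as it contains the vertices. -/
theorem exists_face_of_isFirstDerived {p : Finset E → E}
    (hp : ∀ s ∈ B.faces, p s ∈ openSimplex s) {t : Finset E} {c : Finset (Finset E)}
    (hc : c.Nonempty) (hcB : (c : Set (Finset E)) ⊆ B.faces)
    (hchain : IsChain (· ⊆ ·) (c : Set (Finset E)))
    (htc : (t : Set E) = p '' (c : Set (Finset E))) :
    ∃ m ∈ c, m ∈ B.faces ∧ (∀ s ∈ c, s ⊆ m) ∧ p m ∈ t ∧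
      (∀ v ∈ t, v ∈ convexHull ℝ (m : Set E)) ∧ openSimplex t ⊆ openSimplex m := by
  obtain ⟨m, hm, hmax⟩ := exists_greatest_of_isChain hc hchain
  have hpm : p m ∈ t := by
    rw [← Finset.mem_coe, htc]
    exact mem_image_of_mem p hm
  have hconv : ∀ v ∈ t, v ∈ convexHull ℝ (m : Set E) := by
    intro v hv
    rw [← Finset.mem_coe, htc] at hv
    obtain ⟨s, hs, rfl⟩ := hv
    exact convexHull_mono (Finset.coe_subset.2 (hmax s hs))
      (openSimplex_subset_convexHull s (hp s (hcB hs)))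
  refine ⟨m, hm, hcB hm, hmax, hpm, hconv, ?_⟩
  rintro x ⟨w, hw, h1, rfl⟩
  exact sum_smul_mem_openSimplex (fun v hv => (hw v hv).le) h1 hconv hpm (hw _ hpm)
    (hp m (hcB hm))

/-- Both sides say that the top `m` of the chain is a face of `A`; the vertex `p m` detects this. -/
theorem IsFirstDerived.mem_space_iff (h : IsFirstDerived B B') (hAB : A.faces ⊆ B.faces)
    {t : Finset E} (ht : t ∈ B'.faces) {x : E} (hx : x ∈ openSimplex t) :
    x ∈ A.space ↔ ∀ v ∈ t, v ∈ A.space := by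
  obtain ⟨p, hp, hB'⟩ := h
  obtain ⟨c, hc, hcB, hchain, htc⟩ := (hB' t).1 ht
  obtain ⟨m, hm, hmB, hmax, hpm, hconv, hsub⟩ :=
    exists_face_of_isFirstDerived hp hc hcB hchain htc
  rw [mem_space_iff_mem_faces hAB hmB (hsub hx)]
  constructor
  · exact fun hmA v hv => Geometry.SimplicialComplex.convexHull_subset_space hmA (hconv v hv)
  · exact fun hv => (mem_space_iff_mem_faces hAB hmB (hp m hmB)).1 (hv _ hpm)

/-- Project `x` radially from `p s` to a proper face of `s`, apply induction there, and add `s` to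
the chain obtained. -/
theorem exists_chain_of_mem_convexHull {p : Finset E → E}
    (hp : ∀ s ∈ B.faces, p s ∈ openSimplex s) (k : ℕ) :
    ∀ s ∈ B.faces, s.card = k → ∀ x ∈ convexHull ℝ (s : Set E),
      ∃ c : Finset (Finset E), c.Nonempty ∧ (c : Set (Finset E)) ⊆ B.faces ∧
        IsChain (· ⊆ ·) (c : Set (Finset E)) ∧ (∀ r ∈ c, r ⊆ s) ∧
        x ∈ convexHull ℝ (p '' (c : Set (Finset E))) := by
  classical
  induction k with
  | zero =>
    intro s hs hcard
    exact ((B.nonempty_of_mem_faces hs).ne_empty (Finset.card_eq_zero.1 hcard)).elim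
  | succ k ih =>
    intro s hs hcard x hx
    obtain ⟨w, hw, hw1, hwx⟩ := Finset.mem_convexHull'.1 hx
    obtain ⟨u, hu, hu1, hux⟩ := hp s hs
    -- The minimal ratio `β` is the largest multiple of `p s` that can be subtracted from `x` with
    -- weights still nonnegative; the weight at `v₀` then vanishes.
    obtain ⟨v₀, hv₀, hmin⟩ := s.exists_min_image (fun v => w v / u v) (B.nonempty_of_mem_faces hs)
    set β := w v₀ / u v₀ with hβ
    have hβ0 : 0 ≤ β := div_nonneg (hw v₀ hv₀) (hu v₀ hv₀).le
    have hz : ∀ v ∈ s, 0 ≤ w v - β * u v := fun v hv =>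
      sub_nonneg.2 ((le_div_iff₀ (hu v hv)).1 (hmin v hv))
    have hz0 : w v₀ - β * u v₀ = 0 := by
      rw [hβ, div_mul_cancel₀ _ (hu v₀ hv₀).ne', sub_self]
    have hsum : ∑ v ∈ s, (w v - β * u v) = 1 - β := by
      rw [Finset.sum_sub_distrib, ← Finset.mul_sum, hw1, hu1, mul_one]
    have hsmul : ∑ v ∈ s, (w v - β * u v) • v = x - β • p s := by
      simp_rw [sub_smul, mul_smul]
      rw [Finset.sum_sub_distrib, ← Finset.smul_sum, hwx, hux]
    have hβ1 : 0 ≤ 1 - β := hsum ▸ Finset.sum_nonneg hz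
    -- If `β = 1` then `x = p s`; otherwise the normalized remainder lies in the face opposite `v₀`.
    rcases hβ1.eq_or_lt with h | h
    · refine ⟨{s}, Finset.singleton_nonempty s, by simpa using hs, by simp, by simp, ?_⟩
      have hzero := (Finset.sum_eq_zero_iff_of_nonneg hz).1 (hsum.trans h.symm)
      rw [Finset.sum_eq_zero fun v hv => by rw [hzero v hv, zero_smul],
        show β = 1 by linarith, one_smul] at hsmul
      simpa using (sub_eq_zero.1 hsmul.symm)
    · have hsum' : ∑ v ∈ s.erase v₀, (w v - β * u v) = 1 - β := by
        rw [Finset.sum_erase s hz0, hsum]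
      have hne : (s.erase v₀).Nonempty := by
        rw [Finset.nonempty_iff_ne_empty]
        intro he
        rw [he, Finset.sum_empty] at hsum'
        exact h.ne hsum'
      have hy : (1 - β)⁻¹ • (x - β • p s) ∈ convexHull ℝ ((s.erase v₀ : Finset E) : Set E) := by
        refine Finset.mem_convexHull'.2 ⟨fun v => (1 - β)⁻¹ * (w v - β * u v), fun v hv => ?_, ?_, ?_⟩
        · exact mul_nonneg (inv_nonneg.2 hβ1) (hz v (Finset.mem_of_mem_erase hv))
        · rw [← Finset.mul_sum, hsum', inv_mul_cancel₀ h.ne']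
        · simp_rw [mul_smul]
          rw [← Finset.smul_sum, Finset.sum_erase s (by rw [hz0, zero_smul]), hsmul]
      obtain ⟨c, hc, hcB, hchain, hcs, hyc⟩ := ih (s.erase v₀)
        (B.down_closed hs (Finset.erase_subset _ _) hne)
        (by rw [Finset.card_erase_of_mem hv₀, hcard, Nat.add_sub_cancel]) _ hy
      have hcs' : ∀ r ∈ c, r ⊆ s := fun r hr => (hcs r hr).trans (Finset.erase_subset _ _)
      refine ⟨insert s c, Finset.insert_nonempty _ _, ?_, ?_, ?_, ?_⟩
      · rw [Finset.coe_insert]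
        exact insert_subset hs hcB
      · rw [Finset.coe_insert]
        exact hchain.insert fun r hr _ => Or.inr (hcs' r hr)
      · exact Finset.forall_mem_insert _ _ _ |>.2 ⟨subset_rfl, hcs'⟩
      · rw [Finset.coe_insert, image_insert_eq]
        have hx' : x = β • p s + (1 - β) • ((1 - β)⁻¹ • (x - β • p s)) := by
          rw [smul_inv_smul₀ h.ne']
          abel
        rw [hx']
        exact convex_convexHull ℝ _ (subset_convexHull ℝ _ (mem_insert _ _))
          (convexHull_mono (subset_insert _ _) hyc) hβ0 hβ1 (by ring)

theorem IsFirstDerived.space_eq (h : IsFirstDerived B B') : B'.space = B.space := by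
  classical
  obtain ⟨p, hp, hB'⟩ := h
  ext x
  rw [Geometry.SimplicialComplex.mem_space_iff, Geometry.SimplicialComplex.mem_space_iff]
  constructor
  · rintro ⟨t, ht, hx⟩
    obtain ⟨c, hc, hcB, hchain, htc⟩ := (hB' t).1 ht
    obtain ⟨m, -, hmB, -, -, hconv, -⟩ := exists_face_of_isFirstDerived hp hc hcB hchain htc
    exact ⟨m, hmB, convexHull_min hconv (convex_convexHull ℝ _) hx⟩
  · rintro ⟨s, hs, hx⟩
    obtain ⟨c, hc, hcB, hchain, -, hxc⟩ := exists_chain_of_mem_convexHull hp _ s hs rfl x hx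
    refine ⟨c.image p, (hB' _).2 ⟨c, hc, hcB, hchain, Finset.coe_image⟩, ?_⟩
    rwa [Finset.coe_image]

theorem IsFirstDerived.isLocallyFinite (h : IsFirstDerived B B') (hB : IsLocallyFinite B) :
    IsLocallyFinite B' := by
  classical
  intro x hx
  obtain ⟨U, hU, hfin⟩ := hB x (h.space_eq ▸ hx)
  obtain ⟨p, hp, hB'⟩ := h
  -- A derived simplex meeting `U` lies in its top simplex `m`, which also meets `U`; only finitely
  -- many chains consist of subsets of `m`.
  refine ⟨U, hU, ((hfin.toFinset.biUnion fun m => m.powerset.powerset.image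
    fun c => c.image p).finite_toSet).subset ?_⟩
  rintro t ⟨ht, y, hy, hyU⟩
  obtain ⟨c, hc, hcB, hchain, htc⟩ := (hB' t).1 ht
  obtain ⟨m, -, hmB, hmax, -, hconv, -⟩ := exists_face_of_isFirstDerived hp hc hcB hchain htc
  rw [Finset.mem_coe, Finset.mem_biUnion]
  refine ⟨m, hfin.mem_toFinset.2 ⟨hmB, y, convexHull_min hconv (convex_convexHull ℝ _) hy, hyU⟩, ?_⟩
  rw [Finset.mem_image]
  refine ⟨c, Finset.mem_powerset.2 fun s hs => Finset.mem_powerset.2 (hmax s hs), ?_⟩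
  rw [← Finset.coe_inj, Finset.coe_image, htc]

end DerivedSubdivision

/-! ### Regular neighborhoods as open stars -/

section RegularNeighborhoods

variable {E : Type*} [NormedAddCommGroup E] [NormedSpace ℝ E]

/-- A point of an open simplex of `K` lies in `Z` if and only if all vertices of that simplex do. -/
def IsTriangulatedBy (K : Geometry.SimplicialComplex ℝ E) (Z : Set E) : Prop :=
  ∀ t ∈ K.faces, ∀ x ∈ openSimplex t, x ∈ Z ↔ ∀ v ∈ t, v ∈ Z

variable {K : Geometry.SimplicialComplex ℝ E} {Y Z : Set E}

theorem IsTriangulatedBy.convexHull_subset (hZ : IsTriangulatedBy K Z) {t : Finset E}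
    (ht : t ∈ K.faces) (htZ : ∀ v ∈ t, v ∈ Z) : convexHull ℝ (t : Set E) ⊆ Z := by
  intro x hx
  obtain ⟨s, hs, hst, hxs⟩ := exists_face_mem_openSimplex ht hx
  exact (hZ s hs x hxs).2 fun v hv => htZ v (hst hv)

theorem IsTriangulatedBy.exists_vertex (hY : IsTriangulatedBy K Y) {t : Finset E}
    (ht : t ∈ K.faces) (htY : (convexHull ℝ (t : Set E) ∩ Y).Nonempty) : ∃ v ∈ t, v ∈ Y := by
  obtain ⟨x, hx, hxY⟩ := htY
  obtain ⟨s, hs, hst, hxs⟩ := exists_face_mem_openSimplex ht hx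
  obtain ⟨v, hv⟩ := K.nonempty_of_mem_faces hs
  exact ⟨v, hst hv, (hY s hs x hxs).1 hxY v hv⟩

theorem mem_carrier {T : Set (Finset E)} {x : E} :
    x ∈ carrier T ↔ ∃ s ∈ T, x ∈ convexHull ℝ (s : Set E) := by
  simp only [carrier, mem_iUnion, exists_prop]

theorem convexHull_inter_nonempty {t : Finset E} {v : E} (hv : v ∈ t) (hvY : v ∈ Y) :
    (convexHull ℝ (t : Set E) ∩ Y).Nonempty :=
  ⟨v, subset_convexHull ℝ _ hv, hvY⟩

/-- The simplicial neighbourhood of `Y` without the link of `Y` is the open star of `Y`. -/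
theorem carrier_nbhdFaces_diff_carrier_linkFaces (hY : IsTriangulatedBy K Y) :
    carrier (nbhdFaces Y K.faces) \ carrier (linkFaces Y K.faces) = openStar K Y := by
  ext x
  simp only [mem_sdiff, mem_carrier]
  constructor
  · rintro ⟨⟨s, ⟨hs, t, ht, hst, htY⟩, hx⟩, hlink⟩
    -- If the face `r` with `x` in its interior missed `Y`, it would be a link simplex containing
    -- `x`.
    obtain ⟨r, hr, hrs, hxr⟩ := exists_face_mem_openSimplex hs hx
    refine ⟨r, hr, hxr, hY.exists_vertex hr ?_⟩
    by_contra h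
    exact hlink ⟨r, ⟨⟨hr, t, ht, hrs.trans hst, htY⟩,
      disjoint_iff_inter_eq_empty.2 (not_nonempty_iff_eq_empty.1 h)⟩,
      openSimplex_subset_convexHull r hxr⟩
  · rintro ⟨s, hs, hx, v, hv, hvY⟩
    refine ⟨⟨s, ⟨hs, s, hs, subset_rfl, convexHull_inter_nonempty hv hvY⟩,
      openSimplex_subset_convexHull s hx⟩, ?_⟩
    rintro ⟨t, ⟨⟨ht, -⟩, hdisj⟩, hxt⟩
    exact disjoint_left.1 hdisj
      (subset_convexHull ℝ _ (subset_of_mem_openSimplex hs ht hx hxt hv)) hvY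

/-- A point of `Z` in the star has its whole simplex in `Z`, and that simplex already has a vertex
in `Y`. Thus the filtration of `N` is induced by that of `X`. -/
theorem openStar_inter_carrier_nbhdFaces (hZ : IsTriangulatedBy K Z) :
    openStar K Y ∩ carrier (nbhdFaces Y (facesIn K.faces Z)) = openStar K Y ∩ Z := by
  ext x
  refine and_congr_right fun hx => ?_
  rw [mem_carrier]
  constructor
  · rintro ⟨s, ⟨⟨-, hsZ⟩, -⟩, hxs⟩
    exact hsZ hxs
  · intro hxZ
    obtain ⟨s, hs, hxs, v, hv, hvY⟩ := hx
    have hsT : s ∈ facesIn K.faces Z := ⟨hs, hZ.convexHull_subset hs ((hZ s hs x hxs).1 hxZ)⟩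
    exact ⟨s, ⟨hsT, s, hsT, subset_rfl, convexHull_inter_nonempty hv hvY⟩,
      openSimplex_subset_convexHull s hxs⟩

theorem IsTriangulatedBy.subset_openStar (hY : IsTriangulatedBy K Y) (hYK : Y ⊆ K.space) :
    Y ⊆ openStar K Y := by
  intro x hx
  obtain ⟨t, ht, hxt⟩ := Geometry.SimplicialComplex.mem_space_iff.1 (hYK hx)
  obtain ⟨s, hs, -, hxs⟩ := exists_face_mem_openSimplex ht hxt
  obtain ⟨v, hv⟩ := K.nonempty_of_mem_faces hs
  exact ⟨s, hs, hxs, v, hv, (hY s hs x hxs).1 hx v hv⟩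

/-- The open star of a subcomplex deforms to it along segments that stay in one open simplex until
they reach the subcomplex. -/
theorem exists_deformation_openStar (hK : IsLocallyFinite K) (hY : IsTriangulatedBy K Y)
    (hYK : Y ⊆ K.space) :
    ∃ R : C(openStar K Y × unitInterval, openStar K Y),
      (∀ x, R (x, 1) = x) ∧ (∀ x : openStar K Y, (x : E) ∈ Y → ∀ t, R (x, t) = x) ∧
      (∀ x, (R (x, 0) : E) ∈ Y) ∧
      ∀ (x : openStar K Y) (s : Finset E), s ∈ K.faces → (x : E) ∈ openSimplex s →
        ∀ t : unitInterval, 0 < t → (R (x, t) : E) ∈ openSimplex s := by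
  have hzero : ∀ x ∈ openStar K Y, starRetraction K Y x ∈ Y := by
    intro x hx
    obtain ⟨s, hs, hsY, hxs⟩ := exists_starRetraction_mem hx
    exact (hY s hs _ hxs).2 hsY
  let F : openStar K Y × unitInterval → E := fun q =>
    AffineMap.lineMap (starRetraction K Y q.1) (q.1 : E) (q.2 : ℝ)
  have hF : ∀ (x : openStar K Y) (s : Finset E), s ∈ K.faces → (x : E) ∈ openSimplex s →
      ∀ t : unitInterval, 0 < t → F (x, t) ∈ openSimplex s := fun x s hs hxs t ht =>
    lineMap_starRetraction_mem hs hxs x.2 ht t.2.2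
  have hmem : ∀ q, F q ∈ openStar K Y := by
    rintro ⟨x, t⟩
    -- Time `0` is separate: the endpoint lies in `Y`, possibly outside the initial open simplex.
    rcases unitInterval.nonneg'.eq_or_lt (a := (0 : unitInterval)) (b := t) with rfl | ht
    · refine hY.subset_openStar hYK ?_
      simpa [F] using hzero x x.2
    · obtain ⟨s, hs, hxs, v, hv⟩ := x.2
      exact ⟨s, hs, hF x s hs hxs t ht, v, hv⟩
  have hcont : Continuous F := by
    have h1 : Continuous fun x : openStar K Y => starRetraction K Y x :=
      (continuousOn_starRetraction_openStar hK).domRestrict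
    have h2 : Continuous fun q : openStar K Y × unitInterval => (q.2 : ℝ) :=
      continuous_subtype_val.comp continuous_snd
    simp only [F, AffineMap.lineMap_apply_module]
    exact ((continuous_const.sub h2).smul (h1.comp continuous_fst)).add
      (h2.smul (continuous_subtype_val.comp continuous_fst))
  refine ⟨⟨fun q => ⟨F q, hmem q⟩, hcont.subtype_mk _⟩, fun x => ?_, fun x hx t => ?_, fun x => ?_, hF⟩
  · exact Subtype.ext (by simp [F])
  · obtain ⟨s, hs, hxs, -⟩ := x.2
    refine Subtype.ext ?_
    simp [F, starRetraction_eq_self hs ((hY s hs x hxs).1 hx) hxs]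
  · simpa [F] using hzero x x.2

end RegularNeighborhoods

end StratPL

/-! ### The deformation retraction of an open regular neighborhood -/

theorem mainTheorem9 {E : Type*} [NormedAddCommGroup E] [NormedSpace ℝ E]
    (n k : ℕ) (X : Set E) (S : ℤ → Set E)
    (hX : StratPL.IsStratifiedPLPseudomanifold n X S)
    (hbelow : ∀ i : ℤ, i < k → S i = ∅) (hk : (S k).Nonempty)
    (N : Set E) (Nf : ℤ → Set E)
    (hN : StratPL.IsOpenRegularNbhd X S (S k) N Nf) :
    ∃ R : C(N × unitInterval, N),
      StratPL.IsNearlyStratumPreservingDefRetract N Nf (S k) R := by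
  obtain ⟨_, Vf, _, ⟨B, K, ⟨hBfin, hBX⟩, -, hS, hder, rfl, hVf, rfl⟩, rfl, hNf⟩ := hN
  have htri : ∀ i, StratPL.IsTriangulatedBy K (S i) := by
    intro i t ht x hx
    obtain ⟨A, ⟨hAB, -⟩, hA⟩ := hS i
    rw [← hA]
    exact hder.mem_space_iff hAB ht hx
  have hSX : ∀ i, S i ⊆ X := by
    intro i
    obtain ⟨C, -, hC⟩ := hX.filtration.closed i
    exact hC ▸ inter_subset_left
  have hKX : K.space = X := hder.space_eq.trans hBX
  have hYK : S k ⊆ K.space := hKX ▸ hSX k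
  obtain ⟨R, h1, hfix, h0, hsimplex⟩ := StratPL.exists_deformation_openStar
    (hder.isLocallyFinite hBfin) (htri k) hYK
  have hstar := StratPL.carrier_nbhdFaces_diff_carrier_linkFaces (htri k)
  rw [hstar] at hNf ⊢
  have hNf' : ∀ i, Nf i = StratPL.openStar K (S k) ∩ S i := fun i => by
    rw [hNf, hVf, StratPL.openStar_inter_carrier_nbhdFaces (htri i)]
  refine ⟨R, (htri k).subset_openStar hYK, h1, hfix, h0, fun x => ?_⟩
  obtain ⟨s, hs, hxs, -⟩ := x.2
  have hxX : (x : E) ∈ X := hKX ▸ Geometry.SimplicialComplex.convexHull_subset_space hs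
    (StratPL.openSimplex_subset_convexHull s hxs)
  -- The stratum of `x` is given by the least `i` with `x ∈ S i`; it exists since `S` is empty below
  -- `0` and `S n = X`.
  obtain ⟨i, hi, hmin⟩ := Int.exists_least_of_bdd (P := fun i => (x : E) ∈ S i)
    ⟨0, fun i hi => not_lt.1 fun h => by
      rw [hX.filtration.eq_empty i h] at hi
      exact hi⟩
    ⟨n, by rwa [hX.filtration.eq_total n le_rfl]⟩
  refine ⟨i, fun t ht => ?_⟩
  -- Both points lie in the open simplex of `s`, so each skeleton contains both or neither.
  have hR : ∀ j, (R (x, t) : E) ∈ S j ↔ (x : E) ∈ S j := fun j =>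
    (htri j s hs _ (hsimplex x s hs hxs t ht)).trans (htri j s hs x hxs).symm
  rw [StratPL.stratum, hNf', hNf']
  refine ⟨⟨(R (x, t)).2, (hR i).2 hi⟩, fun h => ?_⟩
  have := hmin _ ((hR _).1 h.2)
  omega
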